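/- A Priestley space is a partially ordered set $(X,\le)$ with a quasi-compact topology $\tau$ such that whenever $y\not\le x$ there is a clopen down-set $U$ with $x\in U$ and $y\notin U$; such a space is compact Hausdorff. It is called Noetherian if the topology $\tau^u$, whose open sets are the $\tau$-open up-sets, is a Noetherian topology on $X$. A partially continuous self-map of $X$ is a continuous map $f\colon X\setminus I(f)\to X$, where $I(f)\subseteq X$ is closed. Put $\xi_0=X$ and $\xi_{n}=f^{-1}(\xi_{n-1})\subseteq X\setminus I(f)$ for $n\ge 1$, so that $\xi_n$ is the domain of the $n$-th iterate $f^n$. For a symmetric neighbourhood $\mathcal E$ of the diagonal in $X\times X$ (that is, a symmetric entourage of the unique uniform structure of $X$), let $R(n,\mathcal E)$ be the minimal cardinality of a set $F\subseteq \xi_n$ such that for every $y\in\xi_n$ there is $x\in F$ with $(f^i(x),f^i(y))\in\mathcal E$ for all $0\le i\le n$. If $\xi_n\neq\emptyset$ for all $n$, the topological entropy of $f$ is \[ h_{\mathrm{top}}(f)=\sup_{\mathcal E}\limsup_{n\to\infty}\frac1n\log R(n,\mathcal E)\in[0,+\infty]. \] **Theorem.** Let $X$ be a non-empty Noetherian Priestley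 space. 1. Let $f\colon X\setminus I(f)\to X$ be a partially continuous self-map of $X$ such that $I(f)$ is clopen and $\xi_n\ne\emptyset$ for all $n\geq 0$. Then $h_{\mathrm{top}}(f)=0$. 2. In particular, every continuous map $f\colon X\to X$ has topological entropy $0$, where the topological entropy of $f$ is $\sup_{\mathfrak U}\lim_{n\to\infty}\frac1n\log N\big(\mathfrak U\vee f^{-1}\mathfrak U\vee\dots\vee f^{-(n-1)}\mathfrak U\big)$, the supremum being over all finite open covers $\mathfrak U$ of $X$, and $N(\mathfrak V)$ denoting the minimal number of members of a cover $\mathfrak V$ that are needed to cover $X$. The map $f$ is not required to be order-preserving. -/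

import Mathlib

/-- The topology `τᵘ` on an ordered topological space whose open sets are the open up-sets. -/
abbrev openUpSetTopology (X : Type*) [TopologicalSpace X] [Preorder X] : TopologicalSpace X where
  IsOpen U := IsOpen U ∧ IsUpperSet U
  isOpen_univ := ⟨isOpen_univ, isUpperSet_univ⟩
  isOpen_inter _ _ hU hV := ⟨hU.1.inter hV.1, hU.2.inter hV.2⟩
  isOpen_sUnion _ h :=
    ⟨isOpen_sUnion fun U hU => (h U hU).1, isUpperSet_sUnion fun U hU => (h U hU).2⟩

/-- A Priestley space is Noetherian when its associated spectral space `(X, τᵘ)` is a Noetherian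
topological space. (A Priestley space is a partially ordered topological space with
`[CompactSpace X] [PriestleySpace X]`.) -/
def IsNoetherianPriestley (X : Type*) [TopologicalSpace X] [Preorder X] : Prop :=
  @TopologicalSpace.NoetherianSpace X (openUpSetTopology X)

/-- A partially continuous self-map of `X`: a closed subset `I` (the indeterminacy set) and a
continuous map `X \ I → X`. -/
structure PartiallyContinuousSelfMap (X : Type*) [TopologicalSpace X] where
  /-- the indeterminacy set -/
  I : Set X
  isClosed_I : IsClosed I
  /-- the underlying map `X \ I → X` -/
  toFun : (Iᶜ : Set X) → X
  continuous_toFun : Continuous toFun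

namespace PartiallyContinuousSelfMap

variable {X : Type*} [TopologicalSpace X] (f : PartiallyContinuousSelfMap X)

/-- The maximal admissible sequence: `ξ₀ = X` and `ξₙ₊₁ = f⁻¹(ξₙ) ⊆ X \ I`; so `ξₙ` is the domain
of the `n`-th iterate of `f`. -/
def xiMax : ℕ → Set X
  | 0 => Set.univ
  | n + 1 => Subtype.val '' (f.toFun ⁻¹' xiMax n)

open Classical in
/-- An auxiliary total map that agrees with `f` off `I` (and is the identity on `I`). It is only
iterated at most `n` times on points of `xiMax n`, so that its values on `I` are never used. -/
noncomputable def extend (x : X) : X :=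
  if h : x ∈ f.Iᶜ then f.toFun ⟨x, h⟩ else x

/-- The dynamical ball `{y ∈ ξₙ | (fⁱ x, fⁱ y) ∈ E for i = 0, …, n}`, for `x ∈ ξₙ`. -/
def dynBall (n : ℕ) (E : Set (X × X)) (x : X) : Set X :=
  {y | y ∈ f.xiMax n ∧ ∀ i ≤ n, (f.extend^[i] x, f.extend^[i] y) ∈ E}

/-- `F ⊆ ξₙ` is an `(n, E)`-covering set: the dynamical balls centred at its points cover `ξₙ`. -/
def IsCoveringSet (n : ℕ) (E : Set (X × X)) (F : Set X) : Prop :=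
  F ⊆ f.xiMax n ∧ f.xiMax n ⊆ ⋃ x ∈ F, f.dynBall n E x

/-- The minimal cardinality `R(n, E)` of an `(n, E)`-covering set. -/
noncomputable def minCovering (n : ℕ) (E : Set (X × X)) : ℕ∞ :=
  ⨅ (F : Set X) (_ : f.IsCoveringSet n E F), F.encard

/-- The topological entropy `sup_E limsup_n (1/n) log R(n, E)` of `f`, with respect to its maximal
admissible sequence. `E` runs over the symmetric entourages of the unique uniform structure of the
compact space `X`, that is, over the symmetric neighbourhoods of the diagonal. The value
is `-∞` when some `ξₙ` is empty. -/
noncomputable def topEntropy : EReal :=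
  ⨆ (E : Set (X × X)) (_ : E ∈ nhdsSet (Set.diagonal X) ∧ ∀ x y, (x, y) ∈ E → (y, x) ∈ E),
    Filter.limsup (fun n : ℕ => ENNReal.log (f.minCovering n E : ENNReal) / (n : EReal))
      Filter.atTop

end PartiallyContinuousSelfMap

/-- The complexity `N(U)` of a family `U` of subsets covering `X`: the minimal number of members
of `U` needed to cover `X`. -/
noncomputable def coverComplexity {X ι : Type*} (U : ι → Set X) : ℕ∞ :=
  ⨅ (S : Finset ι) (_ : ⋃ i ∈ S, U i = Set.univ), (S.card : ℕ∞)

/-- The joint cover `U ∨ f⁻¹(U) ∨ ⋯ ∨ f⁻⁽ⁿ⁻¹⁾(U)`. -/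
def jointCover {X ι : Type*} (f : X → X) (U : ι → Set X) (n : ℕ) : (Fin n → ι) → Set X :=
  fun w => ⋂ i : Fin n, f^[i] ⁻¹' U (w i)

/-- The topological entropy of a continuous self-map: the supremum over all finite open covers `U`
of `lim_n (1/n) log N(U ∨ ⋯ ∨ f⁻⁽ⁿ⁻¹⁾(U))`. The limit exists by subadditivity and is written
as a `limsup`. -/
noncomputable def openCoverEntropy {X : Type*} [TopologicalSpace X] (f : X → X) : EReal :=
  ⨆ (k : ℕ) (U : Fin k → Set X) (_ : (∀ i, IsOpen (U i)) ∧ ⋃ i, U i = Set.univ),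
    Filter.limsup
      (fun n : ℕ => ENNReal.log (coverComplexity (jointCover f U n) : ENNReal) / (n : EReal))
      Filter.atTop

open Filter Topology

/-! Positive entropy would produce an infinite independence set, which the Noetherian condition
forbids. Fix a clopen `c` and let `A i`, `B i` be the points whose `i`-th iterate is defined and
lies in `c`, resp. outside `c`. If exponentially many in/out patterns occurred, Sauer–Shelah would
give independence sets of positive density (`isIndependentOn_of_shatters`,
`card_le_of_forall_card_le`), and an ultrafilter limit of their translates would be an infinite one
(`eventually_card_le_of_isIndependentOn`). To exclude it (`not_hasInfiniteIndependence`), take a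
minimal clopen down-set `Z` carrying infinite independence. Then `Z ∩ A i` and `Z ∩ B i` carry it
too for some `i`, hence so does every neighbourhood of some point of each. By minimality each of
these points is a greatest element of `Z`, so they coincide, although `A i` and `B i` are disjoint.
Clopen sets form a basis, so itineraries through finite clopen covers control both kinds of entropy.
-/

theorem exists_minimal_isClosed {X : Type*} [TopologicalSpace X]
    [TopologicalSpace.NoetherianSpace X] {p : Set X → Prop} (h : ∃ Z, IsClosed Z ∧ p Z) :
    ∃ Z, IsClosed Z ∧ p Z ∧ ∀ W, IsClosed W → p W → W ⊆ Z → W = Z := by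
  obtain ⟨Z₀, hZ₀, hp₀⟩ := h
  obtain ⟨Z, hZ, hmin⟩ := (wellFounded_lt (α := TopologicalSpace.Closeds X)).has_min
    {Z | p Z} ⟨⟨Z₀, hZ₀⟩, hp₀⟩
  refine ⟨Z, Z.2, hZ, fun W hW hpW hWZ => ?_⟩
  by_contra hne
  exact hmin ⟨W, hW⟩ hpW (lt_of_le_of_ne hWZ fun he =>
    hne (congrArg (fun C : TopologicalSpace.Closeds X => (C : Set X)) he))

/-- Descending chain condition for clopen down-sets in a Noetherian Priestley space. -/
theorem IsNoetherianPriestley.exists_minimal_isClopen_isLowerSet {X : Type*} [TopologicalSpace X]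
    [Preorder X] (hX : IsNoetherianPriestley X) {p : Set X → Prop}
    (h : ∃ Z, IsClopen Z ∧ IsLowerSet Z ∧ p Z) :
    ∃ Z, IsClopen Z ∧ IsLowerSet Z ∧ p Z ∧
      ∀ W, IsClopen W → IsLowerSet W → p W → W ⊆ Z → W = Z := by
  have hcl : ∀ {Z : Set X}, IsClopen Z → IsLowerSet Z → IsClosed[openUpSetTopology X] Z :=
    fun hZ hZl => (@isOpen_compl_iff X _ (openUpSetTopology X)).1 ⟨hZ.compl.isOpen, hZl.compl⟩
  obtain ⟨Z₀, hZ₀, hZ₀l, hp₀⟩ := h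
  obtain ⟨Z, -, ⟨hZ, hZl, hp⟩, hmin⟩ := @exists_minimal_isClosed X (openUpSetTopology X) hX
    (fun Z => IsClopen Z ∧ IsLowerSet Z ∧ p Z) ⟨Z₀, hcl hZ₀ hZ₀l, hZ₀, hZ₀l, hp₀⟩
  exact ⟨Z, hZ, hZl, hp, fun W hW hWl hpW => hmin W (hcl hW hWl) ⟨hW, hWl, hpW⟩⟩

/-! ### Infinite independence sets and their absence. -/

section Independence

variable {X : Type*} (A B : ℕ → Set X)

/-- `T` is an independence set for the pairs `(A i, B i)` relative to `Y`: every finite pattern on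
`T` is realised by a point of `Y`. -/
def IsIndependentOn (T : Set ℕ) (Y : Set X) : Prop :=
  ∀ S S' : Finset ℕ, ↑S ⊆ T → ↑S' ⊆ T → Disjoint S S' →
    ∃ x ∈ Y, (∀ i ∈ S, x ∈ A i) ∧ ∀ i ∈ S', x ∈ B i

/-- `Y` carries an infinite independence set. -/
def HasInfiniteIndependence (Y : Set X) : Prop :=
  ∃ T : Set ℕ, T.Infinite ∧ IsIndependentOn A B T Y

variable {A B}

theorem IsIndependentOn.mono {T T' : Set ℕ} {Y Y' : Set X} (h : IsIndependentOn A B T Y)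
    (hT : T' ⊆ T) (hY : Y ⊆ Y') : IsIndependentOn A B T' Y' := by
  intro S S' hS hS' hd
  obtain ⟨x, hx, hx'⟩ := h S S' (hS.trans hT) (hS'.trans hT) hd
  exact ⟨x, hY hx, hx'⟩

theorem HasInfiniteIndependence.mono {Y Y' : Set X} (h : HasInfiniteIndependence A B Y)
    (hY : Y ⊆ Y') : HasInfiniteIndependence A B Y' := by
  obtain ⟨T, hT, h⟩ := h
  exact ⟨T, hT, h.mono subset_rfl hY⟩

theorem not_hasInfiniteIndependence_empty : ¬ HasInfiniteIndependence A B ∅ := by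
  rintro ⟨T, -, h⟩
  obtain ⟨x, hx, -⟩ := h ∅ ∅ (by simp) (by simp) (by simp)
  exact hx

/-- Fixing the pattern on finitely many indices keeps independence on the remaining ones. -/
theorem IsIndependentOn.inter_pattern {T : Set ℕ} {Y : Set X} (h : IsIndependentOn A B T Y)
    {S S' : Finset ℕ} (hS : ↑S ⊆ T) (hS' : ↑S' ⊆ T) (hd : Disjoint S S') :
    IsIndependentOn A B (T \ ↑(S ∪ S'))
      (Y ∩ {x | (∀ i ∈ S, x ∈ A i) ∧ ∀ i ∈ S', x ∈ B i}) := by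
  intro R R' hR hR' hRR
  obtain ⟨x, hx, h1, h2⟩ := h (S ∪ R) (S' ∪ R')
    (by simpa using ⟨hS, hR.trans Set.sdiff_subset⟩)
    (by simpa using ⟨hS', hR'.trans Set.sdiff_subset⟩) (by
      rw [Finset.disjoint_left] at *
      intro a ha ha'
      rcases Finset.mem_union.1 ha with ha | ha <;> rcases Finset.mem_union.1 ha' with hb | hb
      · exact hd ha hb
      · exact (hR' hb).2 (by simp [ha])
      · exact (hR ha).2 (by simp [hb])
      · exact hRR ha hb)
  refine ⟨x, ⟨hx, ?_, ?_⟩, ?_, ?_⟩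
  · exact fun i hi => h1 i (Finset.mem_union_left _ hi)
  · exact fun i hi => h2 i (Finset.mem_union_left _ hi)
  · exact fun i hi => h1 i (Finset.mem_union_right _ hi)
  · exact fun i hi => h2 i (Finset.mem_union_right _ hi)

theorem HasInfiniteIndependence.of_union {Y Y' : Set X}
    (h : HasInfiniteIndependence A B (Y ∪ Y')) :
    HasInfiniteIndependence A B Y ∨ HasInfiniteIndependence A B Y' := by
  obtain ⟨T, hT, h⟩ := h
  by_cases hY : IsIndependentOn A B T Y
  · exact Or.inl ⟨T, hT, hY⟩
  · right
    unfold IsIndependentOn at hY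
    push Not at hY
    obtain ⟨S, S', hS, hS', hd, hn⟩ := hY
    -- Impose the pattern that fails in `Y`: every point realising it lies in `Y'`.
    refine ⟨T \ ↑(S ∪ S'), hT.sdiff (Finset.finite_toSet _),
      (h.inter_pattern hS hS' hd).mono subset_rfl ?_⟩
    rintro x ⟨hx | hx, h1, h2⟩
    · obtain ⟨i, hi, hi'⟩ := hn x hx h1
      exact absurd (h2 i hi) hi'
    · exact hx

/-- A compact set with an infinite independence set has a point all of whose neighbourhoods carry
an infinite independence set. -/
theorem HasInfiniteIndependence.exists_forall_nhds [TopologicalSpace X] {G : Set X}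
    (hG : IsCompact G) (h : HasInfiniteIndependence A B G) :
    ∃ x ∈ G, ∀ t ∈ 𝓝 x, HasInfiniteIndependence A B (t ∩ G) := by
  by_contra! hc
  refine hG.induction_on (p := fun s => ¬ HasInfiniteIndependence A B s)
    not_hasInfiniteIndependence_empty (fun s t hst ht hs => ht (hs.mono hst))
    (fun s t hs ht hst => hst.of_union.elim hs ht) (fun x hx => ?_) h
  obtain ⟨t, ht, ht'⟩ := hc x hx
  exact ⟨t ∩ G, inter_mem (mem_nhdsWithin_of_mem_nhds ht) self_mem_nhdsWithin, ht'⟩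

/-- In a Noetherian Priestley space, a sequence of pairs of disjoint closed sets has no infinite
independence set. -/
theorem not_hasInfiniteIndependence [TopologicalSpace X] [PartialOrder X] [CompactSpace X]
    [PriestleySpace X] (hX : IsNoetherianPriestley X)
    (hA : ∀ i, IsClosed (A i)) (hB : ∀ i, IsClosed (B i)) (hAB : ∀ i, Disjoint (A i) (B i))
    (Y : Set X) : ¬ HasInfiniteIndependence A B Y := by
  intro h
  have huniv : HasInfiniteIndependence A B Set.univ := h.mono (Set.subset_univ _)
  obtain ⟨Z, hZ, hZl, hbig, hmin⟩ := hX.exists_minimal_isClopen_isLowerSet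
    ⟨Set.univ, isClopen_univ, isLowerSet_univ, huniv⟩
  have key : ∀ W : Set X, IsClopen W → IsLowerSet W →
      HasInfiniteIndependence A B (W ∩ Z) → Z ⊆ W := fun W hW hWl hWb =>
    Set.inter_eq_right.1 (hmin _ (hW.inter hZ) (hWl.inter hZl) hWb Set.inter_subset_right)
  obtain ⟨T, hT, hTi⟩ := hbig
  obtain ⟨i, hi⟩ := hT.nonempty
  have hgA : HasInfiniteIndependence A B (Z ∩ A i) :=
    ⟨_, hT.sdiff (Finset.finite_toSet _), (hTi.inter_pattern (S := {i}) (S' := ∅)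
      (by simpa using hi) (by simp) (by simp)).mono subset_rfl
      (Set.inter_subset_inter_right _ fun x hx => hx.1 i (by simp))⟩
  have hgB : HasInfiniteIndependence A B (Z ∩ B i) :=
    ⟨_, hT.sdiff (Finset.finite_toSet _), (hTi.inter_pattern (S := ∅) (S' := {i})
      (by simp) (by simpa using hi) (by simp)).mono subset_rfl
      (Set.inter_subset_inter_right _ fun x hx => hx.2 i (by simp))⟩
  obtain ⟨x, hx, hxn⟩ := hgA.exists_forall_nhds (hZ.isClosed.inter (hA i)).isCompact
  obtain ⟨y, hy, hyn⟩ := hgB.exists_forall_nhds (hZ.isClosed.inter (hB i)).isCompact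
  -- A point `v` at which independence concentrates dominates `Z`: a clopen down-set containing `v`
  -- but not `u` would cut `Z` down, against minimality.
  have hle : ∀ {u v : X} {G : Set X}, u ∈ Z → G ⊆ Z →
      (∀ t ∈ 𝓝 v, HasInfiniteIndependence A B (t ∩ G)) → u ≤ v := by
    intro u v G hu hG hv
    by_contra hn
    obtain ⟨W, hW, hWl, huW, hvW⟩ := exists_isClopen_lower_of_not_le hn
    exact huW (key W hW hWl ((hv W (hW.isOpen.mem_nhds hvW)).mono
      (Set.inter_subset_inter_right _ hG)) hu)
  have hxy : x = y := le_antisymm (hle hx.1 Set.inter_subset_left hyn)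
    (hle hy.1 Set.inter_subset_left hxn)
  exact Set.disjoint_left.1 (hAB i) hx.2 (hxy ▸ hy.2)

end Independence

/-! ### Subexponential growth of realised patterns. -/

section Growth

open Classical in
/-- A finite set of density more than `δ` in `[0, n)` has a translate with at least `δ / 2 * j`
elements in `[0, j)` for all `j` up to `δ / 2 * n`. -/
theorem exists_translate_count_ge {δ : ℝ} (hδ : 0 ≤ δ) {n : ℕ} {S : Finset ℕ}
    (hS : S ⊆ Finset.range n) (hcard : δ * n < S.card) :
    ∃ m : ℕ, ∀ j : ℕ, (j : ℝ) ≤ δ / 2 * n → δ / 2 * j ≤ Nat.count (fun i => m + i ∈ S) j := by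
  -- Start the window where the count lags furthest behind slope `δ / 2`; from there on it keeps up.
  -- Comparison with `0` shows that at least `δ / 2 * n` places remain before `n`.
  obtain ⟨m, hm, hmax⟩ := Finset.exists_max_image (Finset.range (n + 1))
    (fun m => δ / 2 * (m : ℝ) - (Nat.count (· ∈ S) m : ℝ)) ⟨0, by simp⟩
  refine ⟨m, fun j hj => ?_⟩
  have hmn : m ≤ n := by simpa [Nat.lt_succ_iff] using hm
  have hcn : Nat.count (· ∈ S) n = S.card := by
    rw [Nat.count_eq_card_filter_range, Finset.filter_mem_eq_inter,
      Finset.inter_eq_right.2 hS]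
  have h0 : 0 ≤ δ / 2 * (m : ℝ) - (Nat.count (· ∈ S) m : ℝ) := by
    simpa using hmax 0 (by simp)
  have hsplit : (S.card : ℝ) ≤ Nat.count (· ∈ S) m + (n - m) := by
    have h1 := Nat.count_add (· ∈ S) m (n - m)
    have h2 := Nat.count_le (p := fun k => m + k ∈ S) (n := n - m)
    rw [Nat.add_sub_cancel' hmn, hcn] at h1
    have : S.card + m ≤ Nat.count (· ∈ S) m + n := by omega
    have : (S.card : ℝ) + m ≤ Nat.count (· ∈ S) m + n := by exact_mod_cast this
    linarith
  have hmn' : (m : ℝ) ≤ n := by exact_mod_cast hmn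
  have hjn : m + j ≤ n := by
    have : (m : ℝ) + j ≤ n := by nlinarith
    exact_mod_cast this
  have := hmax (m + j) (by simpa [Nat.lt_succ_iff] using hjn)
  rw [Nat.count_add] at this
  push_cast at this
  linarith

variable {X : Type*} {A B : ℕ → Set X}

/-- Finite independence sets of positive density accumulate to an infinite one. -/
theorem eventually_card_le_of_isIndependentOn {g : X → X}
    (hgA : ∀ m i x, x ∈ A (m + i) → g^[m] x ∈ A i) (hgB : ∀ m i x, x ∈ B (m + i) → g^[m] x ∈ B i)
    (h : ¬ HasInfiniteIndependence A B Set.univ) {δ : ℝ} (hδ : 0 < δ) :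
    ∀ᶠ n : ℕ in atTop, ∀ S : Finset ℕ, S ⊆ Finset.range n →
      IsIndependentOn A B S Set.univ → (S.card : ℝ) ≤ δ * n := by
  classical
  by_contra hc
  rw [not_eventually] at hc
  have hex : ∀ r : ℕ, ∃ (S : Finset ℕ) (m : ℕ), IsIndependentOn A B S Set.univ ∧
      ∀ j ≤ r, δ / 2 * j ≤ Nat.count (fun i => m + i ∈ S) j := by
    intro r
    obtain ⟨N, hN⟩ := exists_nat_ge ((r : ℝ) / (δ / 2))
    obtain ⟨n, hn, hn'⟩ := (frequently_atTop.1 hc) N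
    push Not at hn'
    obtain ⟨S, hS, hind, hcard⟩ := hn'
    obtain ⟨m, hm⟩ := exists_translate_count_ge hδ.le hS hcard
    refine ⟨S, m, hind, fun j hj => hm j ?_⟩
    have h1 : (N : ℝ) ≤ n := by exact_mod_cast hn
    have h2 : (j : ℝ) ≤ r := by exact_mod_cast hj
    rw [div_le_iff₀ (by positivity)] at hN
    nlinarith
  choose S m hind hcount using hex
  let U : Ultrafilter ℕ := hyperfilter ℕ
  have hU : (U : Filter ℕ) ≤ atTop := by
    rw [← Nat.cofinite_eq_atTop]; exact hyperfilter_le_cofinite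
  -- The limit of the translates `S r - m r` along `U`. Each initial segment agrees with that of
  -- some translate with `r ≥ j`, so the lower bound on counts survives and `T` is infinite.
  let T : Set ℕ := {i | ∀ᶠ r in (U : Filter ℕ), m r + i ∈ S r}
  refine h ⟨T, ?_, ?_⟩
  · intro hfin
    have hlow : ∀ j : ℕ, δ / 2 * j ≤ Nat.count (· ∈ T) j := by
      intro j
      have h1 : ∀ᶠ r in (U : Filter ℕ), ∀ i ∈ Finset.range j, (m r + i ∈ S r ↔ i ∈ T) := by
        rw [Filter.eventually_all_finset]
        intro i _
        by_cases hi : i ∈ T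
        · filter_upwards [show ∀ᶠ r in (U : Filter ℕ), m r + i ∈ S r from hi] with r hr
          simp [hr, hi]
        · filter_upwards [Ultrafilter.eventually_not.2
            (show ¬ ∀ᶠ r in (U : Filter ℕ), m r + i ∈ S r from hi)] with r hr
          simp [hr, hi]
      obtain ⟨r, hr, hjr⟩ := (h1.and (hU (eventually_ge_atTop j))).exists
      refine (hcount r j hjr).trans ?_
      rw [Nat.count_eq_card_filter_range, Nat.count_eq_card_filter_range,
        Finset.filter_congr hr]
    obtain ⟨j, hj⟩ := exists_nat_gt ((hfin.toFinset.card : ℝ) / (δ / 2))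
    have h1 : Nat.count (· ∈ T) j ≤ hfin.toFinset.card := by
      rw [Nat.count_eq_card_filter_range]
      exact Finset.card_le_card fun i hi => by simpa using (Finset.mem_filter.1 hi).2
    have h2 : (Nat.count (· ∈ T) j : ℝ) ≤ hfin.toFinset.card := by exact_mod_cast h1
    rw [div_lt_iff₀ (by positivity)] at hj
    have := hlow j
    linarith
  · intro R R' hR hR' hd
    have h1 : ∀ᶠ r in (U : Filter ℕ), ∀ i ∈ R, m r + i ∈ S r :=
      (Filter.eventually_all_finset R).2 fun i hi => hR hi
    have h2 : ∀ᶠ r in (U : Filter ℕ), ∀ i ∈ R', m r + i ∈ S r :=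
      (Filter.eventually_all_finset R').2 fun i hi => hR' hi
    obtain ⟨r, hr, hr'⟩ := (h1.and h2).exists
    obtain ⟨x, -, hx, hx'⟩ := hind r (R.map (addLeftEmbedding (m r)))
      (R'.map (addLeftEmbedding (m r)))
      (by intro i hi; obtain ⟨k, hk, rfl⟩ := Finset.mem_map.1 hi; exact hr k hk)
      (by intro i hi; obtain ⟨k, hk, rfl⟩ := Finset.mem_map.1 hi; exact hr' k hk)
      ((Finset.disjoint_map _).2 hd)
    -- Applying `g^[m r]` undoes the translation by `m r`.
    refine ⟨g^[m r] x, Set.mem_univ _, fun i hi => hgA _ _ _ (hx _ ?_),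
      fun i hi => hgB _ _ _ (hx' _ ?_)⟩
    · exact Finset.mem_map.2 ⟨i, hi, rfl⟩
    · exact Finset.mem_map.2 ⟨i, hi, rfl⟩

open Classical in
variable (A B) in
/-- The patterns of length `n` realised by points of `X`. -/
noncomputable def realizedPatterns (n : ℕ) : Finset (Finset ℕ) :=
  (Finset.range n).powerset.filter fun S =>
    ∃ x, ∀ i < n, (i ∈ S → x ∈ A i) ∧ (i ∉ S → x ∈ B i)

theorem mem_realizedPatterns {n : ℕ} {S : Finset ℕ} :
    S ∈ realizedPatterns A B n ↔
      S ⊆ Finset.range n ∧ ∃ x, ∀ i < n, (i ∈ S → x ∈ A i) ∧ (i ∉ S → x ∈ B i) := by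
  simp only [realizedPatterns, Finset.mem_filter, Finset.mem_powerset]

theorem isIndependentOn_of_shatters {n : ℕ} {s : Finset ℕ}
    (hs : (realizedPatterns A B n).Shatters s) :
    s ⊆ Finset.range n ∧ IsIndependentOn A B s Set.univ := by
  have hsub : s ⊆ Finset.range n := by
    obtain ⟨t, ht, hst⟩ := hs.exists_superset
    exact hst.trans (mem_realizedPatterns.1 ht).1
  refine ⟨hsub, fun R R' hR hR' hd => ?_⟩
  obtain ⟨t, ht, hst⟩ := hs (t := R) (by exact_mod_cast hR)
  obtain ⟨x, hx⟩ := (mem_realizedPatterns.1 ht).2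
  refine ⟨x, Set.mem_univ _, fun i hi => ?_, fun i hi => ?_⟩
  · have hit : i ∈ t := by
      rw [← hst] at hi
      exact (Finset.mem_inter.1 hi).2
    exact (hx i (Finset.mem_range.1 (hsub (hR hi)))).1 hit
  · refine (hx i (Finset.mem_range.1 (hsub (hR' hi)))).2 fun hit => ?_
    exact Finset.disjoint_left.1 hd (hst ▸ Finset.mem_inter.2 ⟨hR' hi, hit⟩) hi

/-- A family of subsets of `[0, n)` of size at most `δ * n` is small. -/
theorem card_le_of_forall_card_le {n : ℕ} {𝒮 : Finset (Finset ℕ)} {δ x : ℝ} (hx : 0 < x)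
    (hx1 : x ≤ 1) (h : ∀ s ∈ 𝒮, s ⊆ Finset.range n ∧ (s.card : ℝ) ≤ δ * n) :
    (𝒮.card : ℝ) ≤ Real.exp ((x - δ * Real.log x) * n) := by
  -- Weight each `s` by `x ^ s.card`: since `x ≤ 1`, members of `𝒮` weigh at least `x ^ (δ * n)`,
  -- and all subsets together weigh `(1 + x) ^ n`.
  have h1 : (𝒮.card : ℝ) * x ^ (δ * n) ≤ (1 + x) ^ n := by
    calc (𝒮.card : ℝ) * x ^ (δ * n) = ∑ s ∈ 𝒮, x ^ (δ * n) := by simp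
      _ ≤ ∑ s ∈ 𝒮, x ^ s.card := Finset.sum_le_sum fun s hs => by
          rw [← Real.rpow_natCast]
          exact Real.rpow_le_rpow_of_exponent_ge hx hx1 (h s hs).2
      _ ≤ ∑ s ∈ (Finset.range n).powerset, x ^ s.card :=
          Finset.sum_le_sum_of_subset_of_nonneg
            (fun s hs => Finset.mem_powerset.2 (h s hs).1) fun _ _ _ => by positivity
      _ = (1 + x) ^ n := by
          have := Finset.sum_pow_mul_eq_add_pow x 1 (Finset.range n)
          simpa [add_comm] using this
  have h2 : (1 + x) ^ n ≤ Real.exp (x * n) := by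
    rw [mul_comm, Real.exp_nat_mul]
    exact pow_le_pow_left₀ (by positivity) (by linarith [Real.add_one_le_exp x]) n
  have h3 : x ^ (δ * n) = Real.exp (δ * Real.log x * n) := by
    rw [Real.rpow_def_of_pos hx]; ring_nf
  rw [h3] at h1
  have h4 : Real.exp ((x - δ * Real.log x) * n) =
      Real.exp (x * n) / Real.exp (δ * Real.log x * n) := by
    rw [← Real.exp_sub]; ring_nf
  rw [h4, le_div_iff₀ (Real.exp_pos _)]
  exact h1.trans h2

/-- The number of realised patterns grows subexponentially. -/
theorem eventually_card_realizedPatterns_le {g : X → X}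
    (hgA : ∀ m i x, x ∈ A (m + i) → g^[m] x ∈ A i) (hgB : ∀ m i x, x ∈ B (m + i) → g^[m] x ∈ B i)
    (h : ¬ HasInfiniteIndependence A B Set.univ) {ε : ℝ} (hε : 0 < ε) :
    ∀ᶠ n : ℕ in atTop, ((realizedPatterns A B n).card : ℝ) ≤ Real.exp (ε * n) := by
  obtain ⟨x, hx, hx1, hxε⟩ : ∃ x : ℝ, 0 < x ∧ x ≤ 1 ∧ x ≤ ε / 2 :=
    ⟨min 1 (ε / 2), by positivity, min_le_left _ _, min_le_right _ _⟩
  obtain ⟨δ, hδ, hδε⟩ : ∃ δ : ℝ, 0 < δ ∧ -(δ * Real.log x) ≤ ε / 2 := by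
    have hl : 0 ≤ -Real.log x := by linarith [Real.log_nonpos hx.le hx1]
    -- The summand `1` keeps the denominator positive when `x = 1`.
    refine ⟨ε / 2 / (1 + -Real.log x), by positivity, ?_⟩
    rw [neg_mul_eq_mul_neg, div_mul_eq_mul_div, div_le_iff₀ (by positivity)]
    nlinarith
  filter_upwards [eventually_card_le_of_isIndependentOn hgA hgB h hδ] with n hn
  calc ((realizedPatterns A B n).card : ℝ) ≤ (realizedPatterns A B n).shatterer.card := by
        exact_mod_cast Finset.card_le_card_shatterer _
    _ ≤ Real.exp ((x - δ * Real.log x) * n) := by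
        refine card_le_of_forall_card_le hx hx1 fun s hs => ?_
        obtain ⟨h1, h2⟩ := isIndependentOn_of_shatters (Finset.mem_shatterer.1 hs)
        exact ⟨h1, hn s h1 h2⟩
    _ ≤ Real.exp (ε * n) := by
        gcongr
        linarith

end Growth

/-! ### Itineraries of partially continuous maps. -/

namespace PartiallyContinuousSelfMap

variable {X : Type*} [TopologicalSpace X] (f : PartiallyContinuousSelfMap X)

theorem mem_xiMax_succ {n : ℕ} {x : X} :
    x ∈ f.xiMax (n + 1) ↔ x ∈ f.Iᶜ ∧ f.extend x ∈ f.xiMax n := by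
  constructor
  · rintro ⟨⟨y, hy⟩, h, rfl⟩
    refine ⟨hy, ?_⟩
    rw [extend, dif_pos hy]
    exact h
  · rintro ⟨hx, h⟩
    rw [extend, dif_pos hx] at h
    exact ⟨⟨x, hx⟩, h, rfl⟩

theorem iterate_mem_xiMax {m n : ℕ} {x : X} (h : x ∈ f.xiMax (m + n)) :
    f.extend^[m] x ∈ f.xiMax n := by
  induction m generalizing x with
  | zero => simpa using h
  | succ m ih =>
    rw [Nat.add_right_comm] at h
    exact ih (f.mem_xiMax_succ.1 h).2

theorem xiMax_antitone : Antitone f.xiMax := by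
  refine antitone_nat_of_succ_le fun n => ?_
  induction n with
  | zero => exact Set.subset_univ _
  | succ n ih =>
    intro x hx
    obtain ⟨h1, h2⟩ := f.mem_xiMax_succ.1 hx
    exact f.mem_xiMax_succ.2 ⟨h1, ih h2⟩

theorem continuousOn_extend : ContinuousOn f.extend f.Iᶜ := by
  rw [continuousOn_iff_continuous_domRestrict]
  convert f.continuous_toFun using 1
  ext x
  rw [Set.domRestrict_apply, extend, dif_pos x.2]

/-- The points of the domain of the `n`-th iterate that are sent into `c` by it. -/
def visits (c : Set X) (n : ℕ) : Set X :=
  {x | x ∈ f.xiMax n ∧ f.extend^[n] x ∈ c}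

/-- Preimages of closed sets are closed in `X \ I`, hence in `X`, because `I` is open. -/
theorem isClosed_visits (hI : IsOpen f.I) {c : Set X} (hc : IsClosed c) (n : ℕ) :
    IsClosed (f.visits c n) := by
  induction n with
  | zero => simpa [visits, xiMax] using hc
  | succ n ih =>
    have : f.visits c (n + 1) = f.Iᶜ ∩ f.extend ⁻¹' f.visits c n := by
      ext x
      simp only [visits, Set.mem_ofPred_eq, f.mem_xiMax_succ, Function.iterate_succ_apply,
        Set.mem_inter_iff, Set.mem_preimage, and_assoc]
    rw [this]
    exact f.continuousOn_extend.preimage_isClosed_of_isClosed hI.isClosed_compl ih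

theorem iterate_mem_visits {c : Set X} {m i : ℕ} {x : X} (h : x ∈ f.visits c (m + i)) :
    f.extend^[m] x ∈ f.visits c i := by
  refine ⟨f.iterate_mem_xiMax h.1, ?_⟩
  rw [← Function.iterate_add_apply, Nat.add_comm]
  exact h.2

theorem disjoint_visits (c : Set X) (n : ℕ) : Disjoint (f.visits c n) (f.visits cᶜ n) :=
  Set.disjoint_left.2 fun _ hx hy => hy.2 hx.2

variable [PartialOrder X] [CompactSpace X] [PriestleySpace X]

/-- For finitely many clopen sets, subexponentially many orbit segments realise all itineraries. -/
theorem eventually_exists_finset_itinerary (hX : IsNoetherianPriestley X) (hI : IsOpen f.I)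
    {C : Finset (Set X)} (hC : ∀ c ∈ C, IsClopen c) {ε : ℝ} (hε : 0 < ε) :
    ∀ᶠ n : ℕ in atTop, ∃ F : Finset X, ↑F ⊆ f.xiMax n ∧ (F.card : ℝ) ≤ Real.exp (ε * n) ∧
      ∀ y ∈ f.xiMax n, ∃ x ∈ F, ∀ i ≤ n, ∀ c ∈ C,
        (f.extend^[i] x ∈ c ↔ f.extend^[i] y ∈ c) := by
  classical
  set k := C.card
  let P : Set X → ℕ → Finset (Finset ℕ) := fun c n =>
    realizedPatterns (f.visits c) (f.visits cᶜ) n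
  -- The rate allows for a product over `k` sets and for the length `n + 1 ≤ 2 * n` of the orbit
  -- segments; `k + 1` covers `k = 0`.
  have hP : ∀ᶠ n : ℕ in atTop, ∀ c ∈ C,
      ((P c n).card : ℝ) ≤ Real.exp (ε / (2 * (k + 1)) * n) := by
    rw [Filter.eventually_all_finset]
    intro c hc
    exact eventually_card_realizedPatterns_le (A := f.visits c) (B := f.visits cᶜ)
      (g := f.extend)
      (fun m i x h => f.iterate_mem_visits h) (fun m i x h => f.iterate_mem_visits h)
      (not_hasInfiniteIndependence hX (f.isClosed_visits hI (hC c hc).isClosed)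
        (f.isClosed_visits hI (hC c hc).compl.isClosed) (f.disjoint_visits c) _)
      (by positivity)
  filter_upwards [(tendsto_add_atTop_nat 1).eventually hP, eventually_ge_atTop 1] with n hn hn1
  let code : X → C → Finset ℕ := fun x c =>
    (Finset.range (n + 1)).filter fun i => f.extend^[i] x ∈ c.1
  let Q : Finset (C → Finset ℕ) := Fintype.piFinset fun c : C => P c.1 (n + 1)
  have hcode : ∀ x ∈ f.xiMax n, code x ∈ Q := by
    intro x hx
    refine Fintype.mem_piFinset.2 fun c => mem_realizedPatterns.2 ⟨?_, x, fun i hi => ?_⟩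
    · exact Finset.filter_subset _ _
    · have hxi : x ∈ f.xiMax i := f.xiMax_antitone (Nat.lt_succ_iff.1 hi) hx
      have hi' : i ∈ code x c ↔ f.extend^[i] x ∈ c.1 := by
        simp only [code, Finset.mem_filter, Finset.mem_range, hi, true_and]
      exact ⟨fun h => ⟨hxi, hi'.1 h⟩, fun h => ⟨hxi, fun h' => h (hi'.2 h')⟩⟩
  -- One representative in `ξₙ` for each code that occurs there.
  let Q' := Q.filter fun q => ∃ x ∈ f.xiMax n, code x = q
  have hrep : ∀ q : Q', ∃ x ∈ f.xiMax n, code x = q := fun q => (Finset.mem_filter.1 q.2).2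
  choose rep hrep hrepc using hrep
  refine ⟨Finset.univ.image rep, ?_, ?_, ?_⟩
  · intro x hx
    obtain ⟨q, -, rfl⟩ := Finset.mem_image.1 (Finset.mem_coe.1 hx)
    exact hrep q
  · have h1 : (Finset.univ.image rep).card ≤ ∏ c : C, (P c.1 (n + 1)).card := by
      calc _ ≤ (Finset.univ : Finset Q').card := Finset.card_image_le
        _ = Q'.card := by simp
        _ ≤ Q.card := Finset.card_filter_le _ _
        _ = _ := Fintype.card_piFinset _
    calc ((Finset.univ.image rep).card : ℝ) ≤ ∏ c : C, ((P c.1 (n + 1)).card : ℝ) := by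
          exact_mod_cast h1
      _ ≤ ∏ c : C, Real.exp (ε / (2 * (k + 1)) * (n + 1 : ℕ)) :=
          Finset.prod_le_prod (fun _ _ => by positivity) fun c _ => hn c.1 c.2
      _ = Real.exp (k * (ε / (2 * (k + 1)) * (n + 1 : ℕ))) := by
          rw [Finset.prod_const, Real.exp_nat_mul, Finset.card_univ, Fintype.card_coe]
      _ ≤ Real.exp (ε * n) := by
          have hn1' : (1 : ℝ) ≤ n := by exact_mod_cast hn1
          refine Real.exp_le_exp.2 ?_
          rw [div_mul_eq_mul_div, mul_div_assoc', div_le_iff₀ (by positivity)]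
          push_cast
          have h3 : (n : ℝ) + 1 ≤ 2 * n := by linarith
          have h4 : (0 : ℝ) ≤ k := by positivity
          have h5 : (k : ℝ) * (n + 1) ≤ (k + 1) * (2 * n) := by nlinarith
          nlinarith
  · intro y hy
    let q : Q' := ⟨code y, Finset.mem_filter.2 ⟨hcode y hy, y, hy, rfl⟩⟩
    refine ⟨rep q, Finset.mem_image.2 ⟨q, Finset.mem_univ _, rfl⟩, fun i hi c hc => ?_⟩
    have h1 : code (rep q) ⟨c, hc⟩ = code y ⟨c, hc⟩ := congrFun (hrepc q) _
    have h2 := Finset.ext_iff.1 h1 i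
    simpa only [code, Finset.mem_filter, Finset.mem_range, Nat.lt_succ_iff.2 hi, true_and]
      using h2

end PartiallyContinuousSelfMap

/-! ### Clopen covers and growth rates. -/

/-- A property of sets that holds for small clopen neighbourhoods holds for the members of some
finite clopen cover. -/
theorem exists_finset_isClopen_cover {X : Type*} [TopologicalSpace X] [CompactSpace X]
    {p : Set X → Prop} (h : ∀ x, ∃ c, IsClopen c ∧ x ∈ c ∧ p c) :
    ∃ C : Finset (Set X), (∀ c ∈ C, IsClopen c ∧ p c) ∧ ∀ x, ∃ c ∈ C, x ∈ c := by
  classical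
  choose c hc hxc hp using h
  obtain ⟨t, ht⟩ := CompactSpace.elim_nhds_subcover c fun x => (hc x).isOpen.mem_nhds (hxc x)
  refine ⟨t.image c, fun d hd => ?_, fun x => ?_⟩
  · obtain ⟨x, -, rfl⟩ := Finset.mem_image.1 hd
    exact ⟨hc x, hp x⟩
  · have hx : x ∈ ⋃ y ∈ t, c y := ht ▸ Set.mem_univ x
    obtain ⟨y, hy, hxy⟩ := Set.mem_iUnion₂.1 hx
    exact ⟨c y, Finset.mem_image_of_mem c hy, hxy⟩

/-- Subexponential growth gives a vanishing exponential growth rate. -/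
theorem limsup_log_div_le_zero {u : ℕ → ℕ∞}
    (h : ∀ ε : ℝ, 0 < ε → ∀ᶠ n : ℕ in atTop, ∃ N : ℕ, u n ≤ N ∧ (N : ℝ) ≤ Real.exp (ε * n)) :
    limsup (fun n : ℕ => ENNReal.log (u n : ENNReal) / (n : EReal)) atTop ≤ 0 := by
  rw [← EReal.le_of_forall_lt_iff_le]
  intro ε hε
  have hε' : 0 < ε := by exact_mod_cast hε
  refine limsup_le_of_le (by isBoundedDefault) ?_
  filter_upwards [h ε hε', eventually_gt_atTop 0] with n ⟨N, hN, hNε⟩ hn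
  rw [EReal.div_le_iff_le_mul (by exact_mod_cast hn) (by exact EReal.natCast_ne_top n)]
  calc ENNReal.log (u n : ENNReal) ≤ ENNReal.log (ENNReal.ofReal (Real.exp (ε * n))) := by
        refine ENNReal.log_le_log ?_
        calc (u n : ENNReal) ≤ ((N : ℕ∞) : ENNReal) := ENat.toENNReal_le.2 hN
          _ = (N : ENNReal) := by simp
          _ = ENNReal.ofReal N := by simp
          _ ≤ _ := ENNReal.ofReal_le_ofReal hNε
    _ = ((ε * n : ℝ) : EReal) := by
        rw [ENNReal.log_ofReal_of_pos (Real.exp_pos _), Real.log_exp]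
    _ = (n : EReal) * (ε : EReal) := by
        rw [mul_comm, EReal.coe_mul]; rfl

theorem zero_le_limsup_log_div {u : ℕ → ℕ∞} (h : ∀ n, 1 ≤ u n) :
    0 ≤ limsup (fun n : ℕ => ENNReal.log (u n : ENNReal) / (n : EReal)) atTop := by
  refine le_limsup_of_frequently_le (Frequently.of_forall fun n => ?_) (by isBoundedDefault)
  refine EReal.div_nonneg (ENNReal.zero_le_log_iff.2 ?_) (by positivity)
  simpa using ENat.toENNReal_le.2 (h n)

/-! ### Vanishing of both entropies. -/

section Entropy

variable {X : Type*} [TopologicalSpace X] [PartialOrder X] [CompactSpace X] [PriestleySpace X]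

/-- Cover `X` by finitely many clopen `c` with `c ×ˢ c ⊆ E`; orbits with equal itineraries are then
`E`-close, so representatives of itineraries form a covering set. -/
theorem PartiallyContinuousSelfMap.topEntropy_le_zero (hX : IsNoetherianPriestley X)
    (f : PartiallyContinuousSelfMap X) (hI : IsOpen f.I) : f.topEntropy ≤ 0 := by
  refine iSup₂_le fun E hE => limsup_log_div_le_zero fun ε hε => ?_
  obtain ⟨C, hC, hcov⟩ := exists_finset_isClopen_cover (X := X) (p := fun c => c ×ˢ c ⊆ E) <| by
    intro x
    have hx : E ∈ 𝓝 (x, x) := mem_nhdsSet_iff_forall.1 hE.1 (x, x) rfl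
    rw [nhds_prod_eq, mem_prod_self_iff] at hx
    obtain ⟨t, ht, htE⟩ := hx
    obtain ⟨V, hVt, hV, hxV⟩ := mem_nhds_iff.1 ht
    obtain ⟨c, hc, hxc, hcV⟩ := compact_exists_isClopen_in_isOpen hV hxV
    exact ⟨c, hc, hxc, (Set.prod_mono (hcV.trans hVt) (hcV.trans hVt)).trans htE⟩
  filter_upwards [f.eventually_exists_finset_itinerary hX hI (fun c hc => (hC c hc).1) hε]
    with n ⟨F, hF, hcard, hFcov⟩
  refine ⟨F.card, ?_, hcard⟩
  rw [← Set.encard_coe_eq_coe_finsetCard]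
  refine iInf₂_le (F : Set X) ⟨hF, fun y hy => ?_⟩
  obtain ⟨x, hx, hxy⟩ := hFcov y hy
  refine Set.mem_iUnion₂.2 ⟨x, hx, hy, fun i hi => ?_⟩
  obtain ⟨c, hc, hxc⟩ := hcov (f.extend^[i] x)
  exact (hC c hc).2 ⟨hxc, (hxy i hi c hc).1 hxc⟩

theorem PartiallyContinuousSelfMap.zero_le_topEntropy {X : Type*} [TopologicalSpace X]
    (f : PartiallyContinuousSelfMap X) (hf : ∀ n, (f.xiMax n).Nonempty) : 0 ≤ f.topEntropy := by
  refine le_trans (zero_le_limsup_log_div fun n => ?_)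
    (le_iSup₂_of_le Set.univ ⟨univ_mem, fun _ _ _ => Set.mem_univ _⟩ le_rfl)
  refine le_iInf₂ fun F hF => Set.one_le_encard_iff_nonempty.2 ?_
  obtain ⟨y, hy⟩ := hf n
  obtain ⟨x, hx, -⟩ := Set.mem_iUnion₂.1 (hF.2 hy)
  exact ⟨x, hx⟩

/-- A continuous self-map, regarded as a partially continuous one. -/
def PartiallyContinuousSelfMap.ofContinuous {X : Type*} [TopologicalSpace X] (f : X → X)
    (hf : Continuous f) : PartiallyContinuousSelfMap X where
  I := ∅
  isClosed_I := isClosed_empty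
  toFun x := f x
  continuous_toFun := hf.comp continuous_subtype_val

theorem PartiallyContinuousSelfMap.extend_ofContinuous {X : Type*} [TopologicalSpace X]
    (f : X → X) (hf : Continuous f) : (ofContinuous f hf).extend = f := by
  ext x
  rw [extend, dif_pos (show x ∈ (ofContinuous f hf).Iᶜ from fun h => h)]
  rfl

theorem PartiallyContinuousSelfMap.xiMax_ofContinuous {X : Type*} [TopologicalSpace X]
    (f : X → X) (hf : Continuous f) (n : ℕ) : (ofContinuous f hf).xiMax n = Set.univ := by
  induction n with
  | zero => rfl
  | succ n ih =>
    refine Set.eq_univ_of_forall fun x => (mem_xiMax_succ _).2 ⟨?_, ih ▸ Set.mem_univ _⟩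
    exact fun h => h

theorem openCoverEntropy_le_zero (hX : IsNoetherianPriestley X) {f : X → X} (hf : Continuous f) :
    openCoverEntropy f ≤ 0 := by
  classical
  refine iSup₂_le fun k U => iSup_le fun hU => limsup_log_div_le_zero fun ε hε => ?_
  obtain ⟨C, hC, hcov⟩ := exists_finset_isClopen_cover (X := X) (p := fun c => ∃ i, c ⊆ U i) <| by
    intro x
    obtain ⟨i, hi⟩ := Set.mem_iUnion.1 (hU.2 ▸ Set.mem_univ x)
    obtain ⟨c, hc, hxc, hcU⟩ := compact_exists_isClopen_in_isOpen (hU.1 i) hi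
    exact ⟨c, hc, hxc, i, hcU⟩
  choose c hcC hxc using hcov
  choose j hj using fun x => (hC (c x) (hcC x)).2
  filter_upwards [(PartiallyContinuousSelfMap.ofContinuous f hf).eventually_exists_finset_itinerary
    hX isOpen_empty (fun c hc => (hC c hc).1) hε] with n ⟨F, _, hcard, hFcov⟩
  rw [PartiallyContinuousSelfMap.extend_ofContinuous,
    PartiallyContinuousSelfMap.xiMax_ofContinuous] at hFcov
  -- A point sharing the itinerary of `x` lies in the member of the joint cover indexed by `word x`.
  let word : X → Fin n → Fin k := fun x i => j (f^[i] x)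
  refine ⟨(F.image word).card, iInf₂_le (F.image word) (Set.eq_univ_of_forall fun y => ?_),
    le_trans (by exact_mod_cast Finset.card_image_le) hcard⟩
  obtain ⟨x, hx, hxy⟩ := hFcov y (Set.mem_univ y)
  refine Set.mem_iUnion₂.2 ⟨word x, Finset.mem_image_of_mem _ hx, Set.mem_iInter.2 fun i => ?_⟩
  exact hj _ ((hxy i i.2.le _ (hcC _)).1 (hxc (f^[i] x)))

theorem zero_le_openCoverEntropy {X : Type*} [TopologicalSpace X] [Nonempty X] (f : X → X) :
    0 ≤ openCoverEntropy f := by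
  refine le_trans (zero_le_limsup_log_div fun n => ?_)
    (le_iSup₂_of_le 1 (fun _ => Set.univ) (le_iSup_of_le
      ⟨fun _ => isOpen_univ, Set.iUnion_const _⟩ le_rfl))
  refine le_iInf₂ fun S hS => ?_
  obtain ⟨x⟩ := ‹Nonempty X›
  obtain ⟨w, hw, -⟩ := Set.mem_iUnion₂.1 (hS ▸ Set.mem_univ x)
  exact_mod_cast Finset.card_pos.2 ⟨w, hw⟩

end Entropy

theorem mainTheorem7 {X : Type*} [TopologicalSpace X] [PartialOrder X] [CompactSpace X]
    [PriestleySpace X] [Nonempty X] (hX : IsNoetherianPriestley X) :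
    (∀ f : PartiallyContinuousSelfMap X, IsClopen f.I → (∀ n, (f.xiMax n).Nonempty) →
      f.topEntropy = 0) ∧
    (∀ f : X → X, Continuous f → openCoverEntropy f = 0) := by
  exact ⟨fun f hI hf => le_antisymm (f.topEntropy_le_zero hX hI.isOpen) (f.zero_le_topEntropy hf),
    fun f hf => le_antisymm (openCoverEntropy_le_zero hX hf) (zero_le_openCoverEntropy f)⟩
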